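/- Let $S$ be a finite set and let $\Gamma$ be a connected Coxeter graph with vertex set $S$ and Coxeter matrix $(m_{s,t})_{s,t\in S}$, of small type: $m_{s,t}\in\{2,3\}$ for all distinct $s,t\in S$ (with $s,t$ joined by an edge iff $m_{s,t}=3$). Let $$A(\Gamma)=\langle \sigma_s\ (s\in S)\mid \sigma_s\sigma_t=\sigma_t\sigma_s \text{ if } m_{s,t}=2,\ \ \sigma_s\sigma_t\sigma_s=\sigma_t\sigma_s\sigma_t \text{ if } m_{s,t}=3\rangle$$ be its Artin group, and let $H(\Gamma)=\langle T_s\ (s\in S)\mid T_sT_t=T_tT_s \text{ if } m_{s,t}=2\rangle$. Given integers $m_s\ge 2$ $(s\in S)$, let $f:H(\Gamma)\to A(\Gamma)$ be the homomorphism with $f(T_s)=\sigma_s^{m_s}$. An expression is a finite sequence $W=(T_{s_\ell}^{p_\ell},\dots,T_{s_1}^{p_1})$ with $s_i\in S$ and $p_i\in\mathbb Z\setminus\{0\}$; its length is $\ell$, and it is an expression for $w=T_{s_\ell}^{p_\ell}\cdots T_{s_1}^{p_1}\in H(\Gamma)$. An elementary $M$-operation either (I) replaces two adjacent terms $T_s^{p},T_s^{q}$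 with the same $s$ by the single term $T_s^{p+q}$ if $p+q\ne0$, and deletes them if $p+q=0$, or (II) exchanges two adjacent terms $T_s^p,T_t^q$ with $m_{s,t}=2$. An expression is $M$-reduced if no sequence of elementary $M$-operations makes it shorter, and nontrivial if its length is positive. (1) For every choice of integers $m_s\ge 2$: if $w\in H(\Gamma)$ has a nontrivial $M$-reduced expression, then $f(w)\ne 1$. (2) For every choice of integers $m_s\ge 2$, the homomorphism $f$ is injective. (3) Consequently, for every choice of integers $m_s\ge2$, the elements $\sigma_s^{m_s}$ $(s\in S)$ generate a subgroup of $A(\Gamma)$ with presentation $\langle T_s\ (s\in S)\mid T_sT_t=T_tT_s\text{ if }m_{s,t}=2\rangle$, where $T_s$ corresponds to $\sigma_s^{m_s}$. In particular (the Tits conjecture for these groups), the squares $\sigma_s^2$ $(s\in S)$ generate a subgroup with presentation $\langle Q_s\ (s\in S)\mid Q_sQ_t=Q_tQ_s\text{ if }m_{s,t}=2\rangle$, where $Q_s$ corresponds to $\sigma_s^2$. -/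

import Mathlib

namespace ArtinTits

/-- The alternating product `prod(a, b; m) = a b a ⋯` with `m` factors. -/
def altProd {G : Type*} [Group G] (a b : G) (m : ℕ) : G :=
  if Even m then (a * b) ^ (m / 2) else (a * b) ^ ((m - 1) / 2) * a

/-- The Coxeter graph of a Coxeter matrix (the labels are the entries of the matrix; as everywhere
in Mathlib, the entry `0` of a `CoxeterMatrix` stands for `∞`). -/
def coxeterGraph {S : Type*} (M : CoxeterMatrix S) : SimpleGraph S where
  Adj s t := s ≠ t ∧ M s t ≠ 2
  symm := ⟨fun s t h => ⟨h.1.symm, by rw [M.symmetric t s]; exact h.2⟩⟩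
  loopless := ⟨fun _ h => h.1 rfl⟩

/-- Small type: all off-diagonal entries are `2` or `3`. -/
def IsSmallType {S : Type*} (M : CoxeterMatrix S) : Prop :=
  ∀ s t : S, s ≠ t → M s t = 2 ∨ M s t = 3

/-- The relators `prod(σ_s, σ_t; m_{s,t}) prod(σ_t, σ_s; m_{s,t})⁻¹` with `m_{s,t} ≠ ∞`. -/
def artinRels {S : Type*} (M : CoxeterMatrix S) : Set (FreeGroup S) :=
  {r | ∃ s t : S, M s t ≠ 0 ∧
    r = altProd (FreeGroup.of s) (FreeGroup.of t) (M s t) *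
      (altProd (FreeGroup.of t) (FreeGroup.of s) (M s t))⁻¹}

/-- The Artin group `A(Γ)`. -/
abbrev ArtinGroup {S : Type*} (M : CoxeterMatrix S) : Type _ :=
  PresentedGroup (artinRels M)

/-- The standard generator `σ_s` of `A(Γ)`. -/
def sigma {S : Type*} (M : CoxeterMatrix S) (s : S) : ArtinGroup M :=
  PresentedGroup.of s

/-- The relators `T_s T_t (T_t T_s)⁻¹` with `m_{s,t} = 2`. -/
def commRels {S : Type*} (M : CoxeterMatrix S) : Set (FreeGroup S) :=
  {r | ∃ s t : S, M s t = 2 ∧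
    r = (FreeGroup.of s * FreeGroup.of t) * (FreeGroup.of t * FreeGroup.of s)⁻¹}

/-- The group `H(Γ) = ⟨T_s (s ∈ S) ∣ T_s T_t = T_t T_s whenever m_{s,t} = 2⟩`. -/
abbrev HGroup {S : Type*} (M : CoxeterMatrix S) : Type _ :=
  PresentedGroup (commRels M)

/-- The generator `T_s` of `H(Γ)`. -/
def genT {S : Type*} (M : CoxeterMatrix S) (s : S) : HGroup M :=
  PresentedGroup.of s

theorem sigma_commute {S : Type*} (M : CoxeterMatrix S) {s t : S} (h : M s t = 2) :
    Commute (sigma M s) (sigma M t) := by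
  have key : PresentedGroup.mk (artinRels M)
      ((FreeGroup.of s * FreeGroup.of t) * (FreeGroup.of t * FreeGroup.of s)⁻¹) = 1 := by
    apply PresentedGroup.one_of_mem
    refine ⟨s, t, by omega, ?_⟩
    simp [altProd, h]
  rw [map_mul, map_inv, mul_inv_eq_one, map_mul, map_mul] at key
  exact key

/-- The homomorphism `f : H(Γ) → A(Γ)`, `T_s ↦ σ_s ^ m_s`. -/
def powHom {S : Type*} (M : CoxeterMatrix S) (m : S → ℕ) : HGroup M →* ArtinGroup M :=
  PresentedGroup.toGroup (f := fun s => sigma M s ^ m s) (by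
    rintro r ⟨s, t, h, rfl⟩
    rw [map_mul, map_inv, mul_inv_eq_one, map_mul, map_mul, FreeGroup.lift_apply_of,
      FreeGroup.lift_apply_of]
    exact ((sigma_commute M h).pow_pow (m s) (m t)).eq)

theorem powHom_genT {S : Type*} (M : CoxeterMatrix S) (m : S → ℕ) (s : S) :
    powHom M m (genT M s) = sigma M s ^ m s :=
  PresentedGroup.toGroup.of _

/-- An expression: a finite sequence of syllables `T_s ^ p` with `p` a nonzero integer, written
from left to right. -/
abbrev Expression (S : Type*) : Type _ := List (S × {p : ℤ // p ≠ 0})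

/-- The element `[W]` of `H(Γ)` that an expression `W` represents. -/
def Expression.eval {S : Type*} (M : CoxeterMatrix S) (W : Expression S) : HGroup M :=
  (W.map fun x => genT M x.1 ^ (x.2 : ℤ)).prod

/-- `ElemOp M W W'`: the expression `W'` is obtained from `W` by one elementary `M`-operation. -/
inductive ElemOp {S : Type*} (M : CoxeterMatrix S) : Expression S → Expression S → Prop
  /-- Type I: two adjacent syllables in the same generator are merged. -/
  | merge (U V : Expression S) (s : S) (p q : {p : ℤ // p ≠ 0}) (h : (p : ℤ) + q ≠ 0) :
      ElemOp M (U ++ (s, p) :: (s, q) :: V) (U ++ (s, ⟨(p : ℤ) + q, h⟩) :: V)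
  /-- Type I: two adjacent mutually inverse syllables are deleted. -/
  | cancel (U V : Expression S) (s : S) (p q : {p : ℤ // p ≠ 0}) (h : (p : ℤ) + q = 0) :
      ElemOp M (U ++ (s, p) :: (s, q) :: V) (U ++ V)
  /-- Type II: two adjacent syllables in generators with `m_{s,t} = 2` are exchanged. -/
  | swap (U V : Expression S) (s t : S) (p q : {p : ℤ // p ≠ 0}) (h : M s t = 2) :
      ElemOp M (U ++ (s, p) :: (t, q) :: V) (U ++ (t, q) :: (s, p) :: V)

/-- `W` is `M`-reduced: no sequence of elementary `M`-operations leads to a shorter expression. -/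
def Expression.IsMReduced {S : Type*} (M : CoxeterMatrix S) (W : Expression S) : Prop :=
  ∀ W' : Expression S, Relation.ReflTransGen (ElemOp M) W W' → W.length ≤ W'.length

end ArtinTits

/-!
An Artin group of small type acts on a free group whose letters are arcs of circles, with one circle
for each vertex `s`, crossing those of the vertices `t` with `m_{s,t} = 3`, and with an auxiliary
circle that crosses only the circle of `s`. The generator `σ_s` acts as a Dehn twist along the
circle of `s`: a curve that passes this circle makes an additional turn along it. If `k ≥ 2` or
`k ≤ -2`, then the curve obtained by `σ_s ^ k` contains two full turns in a row, so it passes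
through every point of the circle of `s`. A passage at a point `u` of the circle of `t` persists
under the twists along circles other than those of `t` and `u`, because what a twist inserts
elsewhere cannot cancel the two arcs of the passage.

Let `T_s ^ p` be the first syllable of an `M`-reduced expression. If it commutes with all the other
syllables, these fix the auxiliary circle of `s`. Otherwise the first syllable `T_t ^ q` with which
it does not commute has `t ≠ s` and `m_{s,t} = 3`, and by induction the expression from `T_t ^ q` on
takes some auxiliary circle to a curve that passes the crossing of `t` with `s`; so does everything
that follows `T_s ^ p`. In both cases `T_s ^ p`, which acts as the twist to the power `m_s p`, makes
the curve pass through every point of the circle of `s`, which no auxiliary circle does.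
-/

namespace ArtinTits

open FreeGroup hiding map_mul map_inv map_one

theorem exists_eq_append_cons_of_exists_mem {α : Type*} {p : α → Prop} {l : List α}
    (h : ∃ x ∈ l, p x) : ∃ a x b, l = a ++ x :: b ∧ p x ∧ ∀ z ∈ a, ¬ p z := by
  classical
  obtain ⟨x, hx⟩ : ∃ x, l.find? (p ·) = some x :=
    Option.isSome_iff_exists.1 (List.find?_isSome.2 (by simpa using h))
  obtain ⟨hpx, a, b, hl, ha⟩ := List.find?_eq_some_iff_append.1 hx
  exact ⟨a, x, b, hl, by simpa using hpx, by simpa using ha⟩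

section Insertion

variable {α : Type*}

theorem mk_append_cons (u : List (α × Bool)) (y : α × Bool) (v : List (α × Bool)) :
    mk (u ++ y :: v) = mk u * mk [y] * mk v := by
  rw [mul_mk, mul_mk, List.append_assoc, List.singleton_append]

/-- The endomorphism of a free group that replaces each signed letter `y` by `ι y * y * (ι ȳ)⁻¹`,
where `ȳ` is the inverse letter. -/
def insertHom (ι : α × Bool → FreeGroup α) : Monoid.End (FreeGroup α) :=
  lift fun x => ι (x, true) * of x * (ι (x, false))⁻¹

theorem insertHom_of (ι : α × Bool → FreeGroup α) (x : α) :
    insertHom ι (of x) = ι (x, true) * of x * (ι (x, false))⁻¹ :=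
  lift_apply_of

theorem insertHom_mk_singleton (ι : α × Bool → FreeGroup α) (y : α × Bool) :
    insertHom ι (mk [y]) = ι y * mk [y] * (ι (y.1, !y.2))⁻¹ := by
  obtain ⟨x, _ | _⟩ := y
  · change insertHom ι (of x)⁻¹ = _ * (of x)⁻¹ * _
    rw [map_inv, insertHom_of]
    simp only [mul_inv_rev, inv_inv, mul_assoc, Bool.not_false]
  · exact insertHom_of ι x

theorem end_ext {φ ψ : Monoid.End (FreeGroup α)} (h : ∀ x, φ (of x) = ψ (of x)) : φ = ψ :=
  ext_hom _ _ h

theorem insertHom_one : insertHom (1 : α × Bool → FreeGroup α) = 1 :=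
  end_ext fun x => by simp [insertHom_of]

theorem insertHom_mul_insertHom {ι κ : α × Bool → FreeGroup α}
    (h : ∀ y, insertHom ι (κ y) = κ y) : insertHom ι * insertHom κ = insertHom (κ * ι) :=
  end_ext fun x => by
    rw [Monoid.End.coe_mul, Function.comp_apply]
    simp only [insertHom_of, map_mul, map_inv, h, Pi.mul_apply, mul_inv_rev, mul_assoc]

theorem insertHom_braid {ι κ : α × Bool → FreeGroup α}
    (hof : ∀ x, insertHom ι (of x) = of x ∨ insertHom κ (of x) = of x)
    (hι : ∀ y, insertHom ι (insertHom κ (ι y)) * ι y = insertHom κ (ι y))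
    (hκ : ∀ y, insertHom κ (insertHom ι (κ y)) * κ y = insertHom ι (κ y)) :
    insertHom ι * (insertHom κ * insertHom ι) = insertHom κ * (insertHom ι * insertHom κ) := by
  have key : ∀ {ι κ : α × Bool → FreeGroup α} {x : α}, insertHom κ (of x) = of x →
      (∀ y, insertHom ι (insertHom κ (ι y)) * ι y = insertHom κ (ι y)) →
      insertHom ι (insertHom κ (insertHom ι (of x))) =
        insertHom κ (insertHom ι (insertHom κ (of x))) := by
    intro ι κ x hx h
    rw [hx]
    conv_lhs => rw [insertHom_of]
    simp only [map_mul, map_inv, hx, insertHom_of ι]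
    rw [← mul_assoc, ← mul_assoc, h, mul_assoc, ← mul_inv_rev, h]
  exact end_ext fun x => (hof x).elim (fun hx => (key hx hκ).symm) fun hx => key hx hι

theorem mk_mem_closure_of {C : Set α} {u : List (α × Bool)} (hu : ∀ z ∈ u, z.1 ∈ C) :
    mk u ∈ Subgroup.closure (of '' C) := by
  rw [← MonoidHom.id_apply (FreeGroup α) (mk u), ← lift_of_eq_id, lift_mk]
  refine list_prod_mem fun g hg => ?_
  obtain ⟨⟨x, b⟩, hx, rfl⟩ := List.mem_map.1 hg
  have hof : of x ∈ Subgroup.closure (of '' C) := Subgroup.subset_closure ⟨x, hu _ hx, rfl⟩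
  cases b
  exacts [inv_mem hof, hof]

theorem prod_map_of_mem_closure {C : Set α} {l : List α} (hl : ∀ x ∈ l, x ∈ C) :
    (l.map of).prod ∈ Subgroup.closure (of '' C) :=
  list_prod_mem fun _ hg =>
    let ⟨x, hx, hxg⟩ := List.mem_map.1 hg
    Subgroup.subset_closure ⟨x, hl x hx, hxg⟩

theorem apply_eq_self_of_mem_closure {C : Set α} {φ : Monoid.End (FreeGroup α)}
    (hφ : ∀ x ∈ C, φ (of x) = of x) {g : FreeGroup α} (hg : g ∈ Subgroup.closure (of '' C)) :
    φ g = g :=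
  MonoidHom.eqOn_closure (g := MonoidHom.id _) (by rintro _ ⟨x, hx, rfl⟩; exact hφ x hx) hg

theorem isReduced_cons_append_cons {C : Set α} {y c : α × Bool} {u v : List (α × Bool)}
    (hy : y.1 ∉ C) (hc : c.1 ∉ C) (hu : ∀ z ∈ u, z.1 ∈ C) (hur : IsReduced u)
    (hv : IsReduced (c :: v)) (hyc : u = [] → y.1 = c.1 → y.2 = c.2) :
    IsReduced (y :: (u ++ c :: v)) := by
  cases u with
  | nil => exact isReduced_cons_cons.2 ⟨hyc rfl, hv⟩
  | cons z u =>
    refine isReduced_cons_cons.2 ⟨fun e => absurd (hu z (by simp)) (e ▸ hy), ?_⟩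
    refine List.isChain_append.2 ⟨hur, hv, fun a ha b hb e => ?_⟩
    obtain rfl : c = b := by simpa using hb
    exact absurd (hu a (List.mem_of_getLast? ha)) (e ▸ hc)

/-- `ι` inserts elements of the subgroup generated by `C` next to letters outside `C`, and nothing
next to letters of `C`. -/
structure IsInsertion (C : Set α) (ι : α × Bool → FreeGroup α) : Prop where
  mem_closure : ∀ y, ι y ∈ Subgroup.closure (of '' C)
  eq_one : ∀ y, y.1 ∈ C → ι y = 1

theorem IsInsertion.insertHom_eq_self {C : Set α} {ι : α × Bool → FreeGroup α}
    (hι : IsInsertion C ι) {g : FreeGroup α}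
    (hg : g ∈ Subgroup.closure (of '' C)) : insertHom ι g = g :=
  apply_eq_self_of_mem_closure
    (fun x hx => by rw [insertHom_of, hι.eq_one _ hx, hι.eq_one _ hx, one_mul, inv_one, mul_one]) hg

theorem toWord_mk_of_isReduced [DecidableEq α] {w : List (α × Bool)} (h : IsReduced w) :
    (mk w).toWord = w := by
  rw [toWord_mk, h.reduce_eq]

-- If `y` and `c` were inverse letters, the two values of `ι` would be equal, so `u` would be empty.
theorem snd_eq_of_isReduced_of_inv_mul_mk_mul_eq_one {ι : α × Bool → FreeGroup α}
    {y c : α × Bool} {u v : List (α × Bool)} (h : IsReduced (y :: (u ++ c :: v)))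
    (hu : (ι (y.1, !y.2))⁻¹ * mk u * ι c = 1) (hfst : y.1 = c.1) : y.2 = c.2 := by
  classical
  by_contra hsnd
  have hcy : (y.1, !y.2) = c := Prod.ext hfst (Bool.not_eq.2 hsnd)
  rw [hcy, mul_eq_one_iff_eq_inv, mul_eq_left] at hu
  obtain rfl : u = [] := by
    rw [← toWord_mk_of_isReduced (w := u) (h.infix ⟨[y], c :: v, by simp⟩), hu, toWord_one]
  exact hsnd ((isReduced_cons_cons.1 h).1 hfst)

theorem isReduced_invRev {w : List (α × Bool)} (h : IsReduced w) : IsReduced (invRev w) := by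
  classical
  rw [← toWord_mk_of_isReduced h, ← toWord_inv]
  exact isReduced_toWord

variable [DecidableEq α]

theorem fst_mem_of_mem_toWord {C : Set α} {g : FreeGroup α}
    (hg : g ∈ Subgroup.closure (of '' C)) : ∀ z ∈ g.toWord, z.1 ∈ C := by
  induction hg using Subgroup.closure_induction with
  | mem g hg =>
    obtain ⟨x, hx, rfl⟩ := hg
    simpa using hx
  | one => simp
  | mul g h _ _ ihg ihh =>
    intro z hz
    exact (List.mem_append.1 ((toWord_mul_sublist g h).subset hz)).elim (ihg z) (ihh z)
  | inv g _ ih =>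
    intro z hz
    obtain ⟨y, hy, rfl⟩ : ∃ y ∈ g.toWord, (y.1, !y.2) = z := by
      simpa only [toWord_inv, invRev, List.mem_reverse, List.mem_map] using hz
    exact ih y hy

namespace IsInsertion

variable {C : Set α} {ι : α × Bool → FreeGroup α}

theorem isReduced_cons (hι : IsInsertion C ι) {y : α × Bool} {w : List (α × Bool)}
    (hy : y.1 ∉ C) (h : IsReduced (y :: w)) :
    IsReduced (y :: ((ι (y.1, !y.2))⁻¹ * insertHom ι (FreeGroup.mk w)).toWord) := by
  induction hn : w.length using Nat.strong_induction_on generalizing y w with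
  | _ n ih =>
  by_cases hw : ∃ c ∈ w, c.1 ∉ C
  · obtain ⟨u, c, v, rfl, hc, hu⟩ := exists_eq_append_cons_of_exists_mem hw
    simp only [not_not] at hu
    have hv_red : IsReduced (c :: v) := h.infix ⟨y :: u, [], by simp⟩
    set B := (ι (y.1, !y.2))⁻¹ * FreeGroup.mk u * ι c with hB
    set X := (ι (c.1, !c.2))⁻¹ * insertHom ι (FreeGroup.mk v) with hX
    have hX_red : IsReduced (c :: X.toWord) := ih _ (by simp [← hn]; omega) hc hv_red rfl
    have hBC : B ∈ Subgroup.closure (of '' C) :=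
      mul_mem (mul_mem (inv_mem (hι.mem_closure _)) (mk_mem_closure_of hu)) (hι.mem_closure _)
    have heq : (ι (y.1, !y.2))⁻¹ * insertHom ι (FreeGroup.mk (u ++ c :: v)) =
        FreeGroup.mk (B.toWord ++ c :: X.toWord) := by
      rw [mk_append_cons, mk_append_cons, map_mul, map_mul,
        hι.insertHom_eq_self (mk_mem_closure_of hu), insertHom_mk_singleton, mk_toWord, mk_toWord]
      simp only [hB, hX, mul_assoc]
    have hyc : B.toWord = [] → y.1 = c.1 → y.2 = c.2 := fun hB1 =>
      snd_eq_of_isReduced_of_inv_mul_mk_mul_eq_one h (toWord_eq_nil_iff.1 hB1)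
    have := isReduced_cons_append_cons hy hc (fst_mem_of_mem_toWord hBC) isReduced_toWord hX_red hyc
    rwa [heq, toWord_mk_of_isReduced (this.infix ⟨[y], [], by simp⟩)]
  · push Not at hw
    have hmem := mul_mem (inv_mem (hι.mem_closure (y.1, !y.2))) (mk_mem_closure_of hw)
    rw [hι.insertHom_eq_self (mk_mem_closure_of hw)]
    refine List.isChain_cons.2 ⟨fun z hz e => ?_, isReduced_toWord⟩
    exact absurd (fst_mem_of_mem_toWord hmem z (List.mem_of_head? hz)) (e ▸ hy)

theorem infix_toWord_insertHom (hι : IsInsertion C ι) {a b : α × Bool} (ha : a.1 ∉ C)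
    (hb : b.1 ∉ C) {g : FreeGroup α} (h : [a, b] <:+: g.toWord) :
    a :: (((ι (a.1, !a.2))⁻¹ * ι b).toWord ++ [b]) <:+: (insertHom ι g).toWord := by
  obtain ⟨v, w, hvw⟩ := h
  have hred : IsReduced (v ++ [a, b] ++ w) := hvw ▸ isReduced_toWord
  set P := insertHom ι (FreeGroup.mk v) * ι a with hP
  set Q := (ι (b.1, !b.2))⁻¹ * insertHom ι (FreeGroup.mk w) with hQ
  set B := (ι (a.1, !a.2))⁻¹ * ι b with hB
  have hQ_red : IsReduced (b :: Q.toWord) :=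
    hι.isReduced_cons hb (hred.infix ⟨v ++ [a], [], by simp⟩)
  have hP_red : IsReduced (P.toWord ++ [a]) := by
    have hav : IsReduced ((a.1, !a.2) :: invRev v) := by
      simpa [invRev] using isReduced_invRev (hred.infix (L₁ := v ++ [a]) ⟨[], b :: w, by simp⟩)
    have hPinv : IsReduced ((a.1, !a.2) :: P⁻¹.toWord) := by
      simpa only [hP, ← inv_mk, map_inv, Bool.not_not, Prod.mk.eta, mul_inv_rev] using
        hι.isReduced_cons (y := (a.1, !a.2)) ha hav
    have := isReduced_invRev hPinv
    rw [toWord_inv, invRev_cons, invRev_invRev] at this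
    simpa [invRev] using this
  have heq : insertHom ι g = FreeGroup.mk (P.toWord ++ a :: (B.toWord ++ b :: Q.toWord)) := by
    have hg : g = FreeGroup.mk (v ++ a :: ([] ++ b :: w)) := by
      rw [← mk_toWord (x := g), ← hvw, List.nil_append, List.append_assoc]
      rfl
    rw [hg]
    simp only [mk_append_cons, ← one_eq_mk, one_mul, map_mul, insertHom_mk_singleton, mk_toWord,
      hP, hB, hQ, mul_assoc]
  have hred' : IsReduced (P.toWord ++ a :: (B.toWord ++ b :: Q.toWord)) :=
    List.isChain_split.2 ⟨hP_red, isReduced_cons_append_cons ha hb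
      (fst_mem_of_mem_toWord (mul_mem (inv_mem (hι.mem_closure _)) (hι.mem_closure _)))
      isReduced_toWord hQ_red
      fun _ => (isReduced_cons_cons.1 (hred.infix ⟨v, w, by simp⟩ : IsReduced [a, b])).1⟩
  rw [heq, toWord_mk_of_isReduced hred']
  exact ⟨P.toWord, Q.toWord, by simp⟩

end IsInsertion

/-- The reduced word of `g` or of `g⁻¹` contains the two consecutive letters `a b`. -/
def Passes (a b : α) (g : FreeGroup α) : Prop :=
  [(a, true), (b, true)] <:+: g.toWord ∨ [(a, true), (b, true)] <:+: g⁻¹.toWord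

namespace Passes

variable {a b x y : α} {g g' : FreeGroup α}

theorem inv (h : Passes a b g) : Passes a b g⁻¹ := by
  rw [Passes, inv_inv]
  exact Or.symm h

theorem of_infix (h : Passes a b g) (hg : g.toWord <:+: g'.toWord) :
    Passes a b g' := by
  refine h.imp (·.trans hg) (·.trans ?_)
  rw [toWord_inv, toWord_inv, invRev, invRev, List.reverse_infix]
  exact hg.map _

variable {C : Set α} {ι : α × Bool → FreeGroup α}

theorem insertHom_of_insert_eq_one (h : Passes a b g) (hι : IsInsertion C ι) (ha : a ∉ C)
    (hb : b ∉ C) (hab : (ι (a, false))⁻¹ * ι (b, true) = 1) : Passes a b (insertHom ι g) := by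
  refine h.imp (fun h => ?_) fun h => ?_
  · simpa [hab] using hι.infix_toWord_insertHom ha hb h
  · simpa [hab] using hι.infix_toWord_insertHom ha hb h

theorem insertHom_of_passes_insert (h : Passes a b g) (hι : IsInsertion C ι) (ha : a ∉ C)
    (hb : b ∉ C) (hxy : Passes x y ((ι (a, false))⁻¹ * ι (b, true))) :
    Passes x y (insertHom ι g) := by
  have key : ∀ g : FreeGroup α, [(a, true), (b, true)] <:+: g.toWord →
      Passes x y (insertHom ι g) := fun g h =>
    hxy.of_infix (((List.prefix_append _ _).isInfix.trans (List.suffix_cons _ _).isInfix).trans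
      (hι.infix_toWord_insertHom (a := (a, true)) (b := (b, true)) ha hb h))
  rcases h with h | h
  · exact key g h
  · simpa using (key _ h).inv

end Passes

theorem toWord_prod_map_of (l : List α) : ((l.map of).prod).toWord = l.map (·, true) := by
  have hred : IsReduced (l.map (·, true)) :=
    (List.isChain_map _).2 (List.Pairwise.isChain (List.pairwise_of_forall fun _ _ _ => rfl))
  have hmk : (l.map of).prod = mk (l.map (·, true)) := by
    rw [← MonoidHom.id_apply (FreeGroup α) (mk _), ← lift_of_eq_id, lift_mk, List.map_map]
    rfl
  rw [hmk, toWord_mk_of_isReduced hred]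

theorem passes_prod_map_of_zpow {a b : α} {l : List α} (h : [a, b] <:+: l ++ l) {k : ℤ}
    (hk : 2 ≤ k.natAbs) : Passes a b ((l.map of).prod ^ k) := by
  obtain ⟨j, hj⟩ := Nat.exists_eq_add_of_le hk
  have hnat : Passes a b ((l.map of).prod ^ k.natAbs) := by
    have hpow : (l.map of).prod ^ k.natAbs =
        ((l ++ l ++ (List.replicate j l).flatten).map of).prod := by
      simp [hj, pow_add, sq, List.map_flatten, mul_assoc]
    rw [hpow]
    refine .inl ?_
    rw [toWord_prod_map_of]
    exact (h.trans (List.prefix_append _ _).isInfix).map (·, true)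
  rcases Int.natAbs_eq k with hk | hk
  · rwa [hk, zpow_natCast]
  · rw [hk, zpow_neg, zpow_natCast]
    exact hnat.inv

end Insertion

section Loops

/-- A cyclic order on `S`: `after t` lists the other elements in the order in which they are met
when one goes around once from `t`. -/
structure CyclicListing (S : Type*) where
  after : S → List S
  notMem_after : ∀ t, t ∉ after t
  exists_split : ∀ {t u}, t ≠ u → ∃ p q, after t = p ++ u :: q ∧ after u = q ++ t :: p

namespace CyclicListing

theorem nonempty (S : Type*) [Finite S] : Nonempty (CyclicListing S) := by
  classical
  cases nonempty_fintype S
  have hmem : ∀ t, ∃ pre post, (Finset.univ : Finset S).toList = pre ++ t :: post := fun t =>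
    List.append_of_mem (Finset.mem_toList.2 (Finset.mem_univ t))
  choose pre post hl using hmem
  refine ⟨⟨fun t => post t ++ pre t, fun t => ?_, fun {t u} htu => ?_⟩⟩
  · have hnodup := (Finset.univ : Finset S).nodup_toList
    rw [hl t, List.nodup_middle, List.nodup_cons] at hnodup
    simpa [or_comm] using hnodup.1
  · rcases List.append_eq_append_iff.1 ((hl t).symm.trans (hl u)) with
      ⟨_ | ⟨x, m⟩, hu, ht⟩ | ⟨_ | ⟨x, m⟩, ht, hu⟩
    · exact absurd (List.cons.inj ht).1 htu
    · obtain ⟨rfl, hpost⟩ := List.cons.inj ht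
      exact ⟨m, post u ++ pre t, by simp [hpost], by simp [hu]⟩
    · exact absurd (List.cons.inj hu).1.symm htu
    · obtain ⟨rfl, hpost⟩ := List.cons.inj hu
      exact ⟨post t ++ pre u, m, by simp [ht], by simp [hpost]⟩

end CyclicListing

/-- The letters of the free group. There is a circle `Sum.inl s` and an auxiliary circle `Sum.inr s`
for each vertex `s`. The letter `(v, u, false)` stands for the arc of the circle `v` that arrives at
its point `u`, and `(v, u, true)` for the one that departs from it. -/
abbrev Letter (S : Type*) : Type _ := (S ⊕ S) × S × Bool

variable {S : Type*}

/-- The letters of the circle of `s`. -/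
def circleLetters (s : S) : Set (Letter S) := {x | x.1 = Sum.inl s}

/-- The arcs of the circle of `s` that lead through the points of `p` in this order. -/
def passWord (s : S) (p : List S) : List (Letter S) :=
  p.flatMap fun u => [(Sum.inl s, u, false), (Sum.inl s, u, true)]

/-- The circle of `s`, read once around from its point `t`. -/
def loopWord (o : CyclicListing S) (s t : S) : List (Letter S) :=
  (Sum.inl s, t, true) :: (passWord s (o.after t) ++ [(Sum.inl s, t, false)])

/-- The element of the free group that is read once around the circle of `s` from its point `t`. -/
def loop (o : CyclicListing S) (s t : S) : FreeGroup (Letter S) :=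
  ((loopWord o s t).map of).prod

theorem mem_passWord {s : S} {p : List S} {x : Letter S} :
    x ∈ passWord s p ↔ x.1 = Sum.inl s ∧ x.2.1 ∈ p := by
  obtain ⟨v, u, _ | _⟩ := x <;> simp [passWord, and_comm]

theorem passWord_append_cons (s : S) (p : List S) (u : S) (q : List S) :
    passWord s (p ++ u :: q) =
      passWord s p ++ (Sum.inl s, u, false) :: (Sum.inl s, u, true) :: passWord s q := by
  simp [passWord]

theorem loop_mem_closure (o : CyclicListing S) (s t : S) :
    loop o s t ∈ Subgroup.closure (of '' circleLetters s) := by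
  refine prod_map_of_mem_closure fun x hx => ?_
  simp only [loopWord, List.mem_cons, List.mem_append, mem_passWord, List.not_mem_nil,
    or_false] at hx
  rcases hx with rfl | hx | rfl
  exacts [rfl, hx.1, rfl]

theorem infix_loopWord_append_loopWord (o : CyclicListing S) (s t u : S) :
    [(Sum.inl s, u, false), (Sum.inl s, u, true)] <:+: loopWord o s t ++ loopWord o s t := by
  rcases eq_or_ne t u with rfl | htu
  · exact ⟨(Sum.inl s, t, true) :: passWord s (o.after t),
      passWord s (o.after t) ++ [(Sum.inl s, t, false)], by simp [loopWord]⟩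
  · obtain ⟨p, q, ht, -⟩ := o.exists_split htu
    refine List.infix_append_of_infix_left ?_
    rw [loopWord, ht, passWord_append_cons]
    exact ⟨(Sum.inl s, t, true) :: passWord s p, passWord s q ++ [(Sum.inl s, t, false)], by simp⟩

theorem exists_loop_eq (o : CyclicListing S) (s t : S) :
    ∃ g ∈ Subgroup.closure (of '' {x ∈ circleLetters s | x.2.1 ≠ t}),
      loop o s t = of (Sum.inl s, t, true) * g * of (Sum.inl s, t, false) := by
  refine ⟨((passWord s (o.after t)).map of).prod, prod_map_of_mem_closure fun x hx => ?_, ?_⟩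
  · obtain ⟨hx, ht⟩ := mem_passWord.1 hx
    exact ⟨hx, fun h => o.notMem_after t (h ▸ ht)⟩
  · simp [loop, loopWord, mul_assoc]

theorem exists_loop_eq_of_ne (o : CyclicListing S) (s : S) {t u : S} (htu : t ≠ u) :
    ∃ g ∈ Subgroup.closure (of '' {x ∈ circleLetters s | x.2.1 ≠ t}),
      ∃ h ∈ Subgroup.closure (of '' {x ∈ circleLetters s | x.2.1 ≠ t}),
        loop o s t = of (Sum.inl s, t, true) * g * (h * of (Sum.inl s, t, false)) ∧
        loop o s u = h * of (Sum.inl s, t, false) * (of (Sum.inl s, t, true) * g) := by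
  obtain ⟨p, q, ht, hu⟩ := o.exists_split htu
  have hnot : t ∉ p ++ u :: q := ht ▸ o.notMem_after t
  simp only [List.mem_append, List.mem_cons, not_or] at hnot
  refine ⟨((passWord s p ++ [(Sum.inl s, u, false)]).map of).prod,
    prod_map_of_mem_closure fun x hx => ?_,
    (((Sum.inl s, u, true) :: passWord s q).map of).prod,
    prod_map_of_mem_closure fun x hx => ?_, ?_, ?_⟩
  · rcases List.mem_append.1 hx with hx | hx
    · obtain ⟨hx, hxp⟩ := mem_passWord.1 hx
      exact ⟨hx, fun h => hnot.1 (h ▸ hxp)⟩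
    · obtain rfl := List.mem_singleton.1 hx
      exact ⟨rfl, htu.symm⟩
  · rcases List.mem_cons.1 hx with rfl | hx
    · exact ⟨rfl, htu.symm⟩
    · obtain ⟨hx, hxq⟩ := mem_passWord.1 hx
      exact ⟨hx, fun h => hnot.2.2 (h ▸ hxq)⟩
  · simp [loop, loopWord, ht, passWord_append_cons, mul_assoc]
  · simp [loop, loopWord, hu, passWord_append_cons, mul_assoc]

end Loops

section Twist

variable {S : Type*}

/-- The vertex whose name the circle `v` carries. -/
def node : S ⊕ S → S := Sum.elim id id

/-- The circle `v` crosses the circle of `s` (at their points `s` and `node v`). The circles of two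
vertices cross if they are adjacent in the Coxeter graph, and the auxiliary circle of `t` crosses
the circle of `t` only. -/
def Crosses (M : CoxeterMatrix S) (v : S ⊕ S) (s : S) : Prop :=
  Sum.elim (fun t => M t s = 3) (fun t => t = s) v

theorem not_crosses_self (M : CoxeterMatrix S) (s : S) : ¬ Crosses M (Sum.inl s) s := by
  simp [Crosses]

variable [LinearOrder S] {M : CoxeterMatrix S} {o : CyclicListing S} {s t u : S}

open Classical in
/-- The insertion of the twist with exponent `k` along the circle of `s`: a curve that runs along
`v` through a crossing with the circle of `s` makes `k` turns along this circle. Whether they are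
inserted before the departing or after the arriving arc depends on the order of the vertices, so
that the two twists at a crossing use opposite sides. -/
noncomputable def twistInsertion (M : CoxeterMatrix S) (o : CyclicListing S) (s : S) (k : ℤ)
    (y : Letter S × Bool) : FreeGroup (Letter S) :=
  if y.1.2.1 = s ∧ Crosses M y.1.1 s ∧ y.1.2.2 = y.2 ∧ (y.2 = true ↔ s ≤ node y.1.1) then
    loop o s (node y.1.1) ^ k
  else 1

/-- The `k`-th power of the twist along the circle of `s`. -/
noncomputable def twist (M : CoxeterMatrix S) (o : CyclicListing S) (s : S) (k : ℤ) :
    Monoid.End (FreeGroup (Letter S)) :=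
  insertHom (twistInsertion M o s k)

theorem twistInsertion_eq_one {k : ℤ} {y : Letter S × Bool}
    (h : y.1.2.1 = s → ¬ Crosses M y.1.1 s) : twistInsertion M o s k y = 1 :=
  if_neg fun hy => h hy.1 hy.2.1

theorem isInsertion_twistInsertion (M : CoxeterMatrix S) (o : CyclicListing S) (s : S) (k : ℤ) :
    IsInsertion (circleLetters s) (twistInsertion M o s k) where
  mem_closure y := by
    unfold twistInsertion
    split_ifs
    exacts [zpow_mem (loop_mem_closure o s _) k, one_mem _]
  eq_one y hy := twistInsertion_eq_one fun _ => by rw [hy]; exact not_crosses_self M s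

theorem twist_of_eq_self {k : ℤ} {x : Letter S} (h : x.2.1 = s → ¬ Crosses M x.1 s) :
    twist M o s k (of x) = of x := by
  rw [twist, insertHom_of, twistInsertion_eq_one h, twistInsertion_eq_one h, one_mul, inv_one,
    mul_one]

theorem twist_eq_self_of_mem_closure {k : ℤ} {C : Set (Letter S)}
    (hC : ∀ x ∈ C, x.2.1 = s → ¬ Crosses M x.1 s) {g : FreeGroup (Letter S)}
    (hg : g ∈ Subgroup.closure (of '' C)) : twist M o s k g = g :=
  apply_eq_self_of_mem_closure (fun x hx => twist_of_eq_self (hC x hx)) hg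

theorem twist_loop_of_not_crosses {k : ℤ} (h : ¬ Crosses M (Sum.inl t) s) :
    twist M o s k (loop o t u) = loop o t u :=
  twist_eq_self_of_mem_closure (fun x hx _ => by rwa [show x.1 = _ from hx])
    (loop_mem_closure o t u)

theorem twist_twistInsertion_of_not_crosses {k j : ℤ} (h : ¬ Crosses M (Sum.inl t) s)
    (y : Letter S × Bool) :
    twist M o s k (twistInsertion M o t j y) = twistInsertion M o t j y := by
  unfold twistInsertion
  split_ifs
  · rw [map_zpow, twist_loop_of_not_crosses h]
  · rw [map_one]

theorem twist_mul_twist (M : CoxeterMatrix S) (o : CyclicListing S) (s : S) (k j : ℤ) :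
    twist M o s k * twist M o s j = twist M o s (k + j) := by
  rw [twist, twist, insertHom_mul_insertHom
    (twist_twistInsertion_of_not_crosses (not_crosses_self M s)), twist]
  congr 1
  funext y
  simp only [twistInsertion, Pi.mul_apply]
  split_ifs
  · rw [← zpow_add, add_comm]
  · rw [one_mul]

theorem twist_zero (M : CoxeterMatrix S) (o : CyclicListing S) (s : S) : twist M o s 0 = 1 := by
  rw [twist, show twistInsertion M o s 0 = 1 from funext fun y => by simp [twistInsertion],
    insertHom_one]

theorem twist_commute (h : M s t = 2) (o : CyclicListing S) (k j : ℤ) :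
    Commute (twist M o s k) (twist M o t j) := by
  have hst : ¬ Crosses M (Sum.inl s) t := by simp [Crosses, h]
  have hts : ¬ Crosses M (Sum.inl t) s := by simp [Crosses, M.symmetric t s, h]
  have hne : s ≠ t := by rintro rfl; simp at h
  rw [commute_iff_eq, twist, twist,
    insertHom_mul_insertHom (twist_twistInsertion_of_not_crosses hts),
    insertHom_mul_insertHom (twist_twistInsertion_of_not_crosses hst)]
  congr 1
  funext y
  rcases ne_or_eq y.1.2.1 s with hs | hs
  · simp [Pi.mul_apply, twistInsertion_eq_one (s := s) fun h => absurd h hs]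
  · simp [Pi.mul_apply, twistInsertion_eq_one (s := t) fun h => absurd (hs.symm.trans h) hne]

theorem twist_of_departing (o : CyclicListing S) (h : M s t = 3) :
    twist M o t 1 (of (Sum.inl s, t, true)) =
      (if t ≤ s then loop o t s else 1) * of (Sum.inl s, t, true) := by
  simp [twist, insertHom_of, twistInsertion, Crosses, node, h]

theorem twist_of_arriving (o : CyclicListing S) (h : M s t = 3) :
    twist M o t 1 (of (Sum.inl s, t, false)) =
      of (Sum.inl s, t, false) * (if t ≤ s then 1 else (loop o t s)⁻¹) := by
  split_ifs with hle <;> simp [twist, insertHom_of, twistInsertion, Crosses, node, h, hle]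

theorem twist_eq_self_of_avoids {g : FreeGroup (Letter S)}
    (hg : g ∈ Subgroup.closure (of '' {x ∈ circleLetters s | x.2.1 ≠ t})) (k : ℤ) :
    twist M o t k g = g :=
  twist_eq_self_of_mem_closure (fun _ hx ht => absurd ht hx.2) hg

theorem twist_loop (o : CyclicListing S) (h : M s t = 3) :
    twist M o t 1 (loop o s t) = (if t ≤ s then loop o t s else 1) * loop o s t *
      (if t ≤ s then 1 else (loop o t s)⁻¹) := by
  obtain ⟨g, hg, hloop⟩ := exists_loop_eq o s t
  rw [hloop, map_mul, map_mul, twist_of_departing o h, twist_of_arriving o h,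
    twist_eq_self_of_avoids hg]
  simp only [mul_assoc]

theorem twist_eq_self_of_mem_closure_circleLetters {g : FreeGroup (Letter S)}
    (hg : g ∈ Subgroup.closure (of '' circleLetters s)) (k : ℤ) : twist M o s k g = g :=
  (isInsertion_twistInsertion M o s k).insertHom_eq_self hg

-- Since the twists use opposite sides, `c` is the circle of `t` read from `s` if `t ≤ s`, and its
-- inverse otherwise. It replaces the passage of the circle of `s` through its point `t`.
theorem exists_twist_loop (o : CyclicListing S) (hst : s ≠ t) (h : M s t = 3) :
    ∃ c, twist M o s 1 c * loop o s t = c ∧ ∀ u, ∃ f g, loop o s t = f * g ∧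
      loop o s u = g * f ∧ twist M o s 1 f = f ∧ twist M o s 1 g = g ∧
      twist M o t 1 (loop o s u) = g * c * f := by
  have hts : M t s = 3 := M.symmetric t s ▸ h
  have hfix : ∀ {g}, g ∈ Subgroup.closure (of '' circleLetters s) → twist M o s 1 g = g :=
    fun hg => twist_eq_self_of_mem_closure_circleLetters hg 1
  refine ⟨(if t ≤ s then 1 else (loop o t s)⁻¹) * if t ≤ s then loop o t s else 1, ?_, fun u => ?_⟩
  · rcases hst.lt_or_gt with hlt | hlt
    · simp [hlt.not_ge, hlt.le, twist_loop o hts]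
    · simp [hlt.not_ge, hlt.le, twist_loop o hts]
  rcases eq_or_ne t u with rfl | htu
  · by_cases hle : t ≤ s
    · exact ⟨loop o s t, 1, by simp, by simp, hfix (loop_mem_closure o s t), map_one _,
        by simp [twist_loop o h, hle]⟩
    · exact ⟨1, loop o s t, by simp, by simp, map_one _, hfix (loop_mem_closure o s t),
        by simp [twist_loop o h, hle]⟩
  · obtain ⟨f, hf, g, hg, hloop, hloop'⟩ := exists_loop_eq_of_ne o s htu
    have hsub : Subgroup.closure (of '' {x ∈ circleLetters s | x.2.1 ≠ t}) ≤
        Subgroup.closure (of '' circleLetters s) :=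
      Subgroup.closure_mono (Set.image_mono fun x hx => hx.1)
    have hof : ∀ b, of (Sum.inl s, t, b) ∈ Subgroup.closure (of '' circleLetters s) := fun b =>
      Subgroup.subset_closure ⟨_, rfl, rfl⟩
    refine ⟨_, _, hloop, hloop', hfix (mul_mem (hof true) (hsub hf)),
      hfix (mul_mem (hsub hg) (hof false)), ?_⟩
    rw [hloop', map_mul, map_mul, map_mul, twist_of_departing o h, twist_of_arriving o h,
      twist_eq_self_of_avoids hf, twist_eq_self_of_avoids hg]
    simp only [mul_assoc]

theorem twist_twist_loop_mul_loop (o : CyclicListing S) (hst : s ≠ t) (h : M s t = 3) (u : S) :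
    twist M o s 1 (twist M o t 1 (loop o s u)) * loop o s u = twist M o t 1 (loop o s u) := by
  obtain ⟨c, hc, hu⟩ := exists_twist_loop o hst h
  obtain ⟨f, g, hfg, hgf, hf, hg, hct⟩ := hu u
  rw [hct, map_mul, map_mul, hf, hg, hgf, mul_assoc (g * _), ← mul_assoc f, ← hfg]
  calc g * twist M o s 1 c * (loop o s t * f)
      = g * (twist M o s 1 c * loop o s t) * f := by simp only [mul_assoc]
    _ = g * c * f := by rw [hc]

theorem twist_twist_twistInsertion (o : CyclicListing S) (hst : s ≠ t) (h : M s t = 3)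
    (y : Letter S × Bool) :
    twist M o s 1 (twist M o t 1 (twistInsertion M o s 1 y)) * twistInsertion M o s 1 y =
      twist M o t 1 (twistInsertion M o s 1 y) := by
  unfold twistInsertion
  split_ifs
  · rw [zpow_one, twist_twist_loop_mul_loop o hst h]
  · simp only [map_one, mul_one]

theorem twist_braid (o : CyclicListing S) (hst : s ≠ t) (h : M s t = 3) :
    twist M o s 1 * (twist M o t 1 * twist M o s 1) =
      twist M o t 1 * (twist M o s 1 * twist M o t 1) := by
  refine insertHom_braid (fun x => ?_) (twist_twist_twistInsertion o hst h)
    (twist_twist_twistInsertion o hst.symm (M.symmetric t s ▸ h))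
  rcases ne_or_eq x.2.1 s with hs | hs
  · exact .inl (twist_of_eq_self fun h => absurd h hs)
  · exact .inr (twist_of_eq_self fun h => absurd (hs.symm.trans h) hst)

theorem passes_twist {v : S ⊕ S} (k : ℤ) (hv : v ≠ Sum.inl s) (hu : u ≠ s)
    {g : FreeGroup (Letter S)} (h : Passes (v, u, false) (v, u, true) g) :
    Passes (v, u, false) (v, u, true) (twist M o s k g) :=
  h.insertHom_of_insert_eq_one (isInsertion_twistInsertion M o s k) hv hv <| by
    rw [twistInsertion_eq_one fun h => absurd h hu, twistInsertion_eq_one fun h => absurd h hu,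
      inv_one, one_mul]

theorem passes_twist_of_crosses {v : S ⊕ S} (hv : Crosses M v s) (u : S) {k : ℤ}
    (hk : 2 ≤ k.natAbs) {g : FreeGroup (Letter S)} (h : Passes (v, s, false) (v, s, true) g) :
    Passes (Sum.inl s, u, false) (Sum.inl s, u, true) (twist M o s k g) := by
  have hvs : v ≠ Sum.inl s := by
    rintro rfl
    exact not_crosses_self M s hv
  have hloop : Passes (Sum.inl s, u, false) (Sum.inl s, u, true) (loop o s (node v) ^ k) :=
    passes_prod_map_of_zpow (infix_loopWord_append_loopWord o s (node v) u) hk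
  refine h.insertHom_of_passes_insert (isInsertion_twistInsertion M o s k) hvs hvs ?_
  by_cases hle : s ≤ node v
  · simpa [twistInsertion, hv, hle] using hloop
  · simpa [twistInsertion, hv, hle] using hloop.inv

end Twist

section Action

variable {S : Type*} [LinearOrder S] {M : CoxeterMatrix S}

/-- The powers of the twist along the circle of `s`, as invertible endomorphisms. -/
noncomputable def twistHom (M : CoxeterMatrix S) (o : CyclicListing S) (s : S) :
    Multiplicative ℤ →* (Monoid.End (FreeGroup (Letter S)))ˣ :=
  MonoidHom.toHomUnits
    { toFun := fun k => twist M o s k.toAdd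
      map_one' := twist_zero M o s
      map_mul' := fun k j => (twist_mul_twist M o s k.toAdd j.toAdd).symm }

/-- The action of an Artin group of small type in which `σ_s` acts by the twist along the circle
of `s`. -/
noncomputable def artinAction (hM : IsSmallType M) (o : CyclicListing S) :
    ArtinGroup M →* (Monoid.End (FreeGroup (Letter S)))ˣ :=
  PresentedGroup.toGroup (f := fun s => twistHom M o s (Multiplicative.ofAdd 1)) (by
    rintro r ⟨s, t, -, rfl⟩
    rcases eq_or_ne s t with rfl | hst
    · exact (map_mul _ _ _).trans (by rw [map_inv, mul_inv_cancel])
    rw [map_mul, map_inv, mul_inv_eq_one]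
    rcases hM s t hst with h | h
    · simp only [altProd, h, even_two, if_true, Nat.div_self two_pos, pow_one, map_mul,
        lift_apply_of]
      exact Units.ext (twist_commute h o 1 1).eq
    · simp only [altProd, h, map_mul, lift_apply_of, if_neg (show ¬ Even 3 by decide),
        Nat.add_one_sub_one, Nat.div_self two_pos, pow_one, mul_assoc]
      exact Units.ext (twist_braid o hst h))

theorem coe_artinAction_sigma_zpow (hM : IsSmallType M) (o : CyclicListing S) (s : S) (k : ℤ) :
    (artinAction hM o (sigma M s ^ k) : Monoid.End (FreeGroup (Letter S))) = twist M o s k := by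
  have h : artinAction hM o (sigma M s) = twistHom M o s (Multiplicative.ofAdd 1) :=
    PresentedGroup.toGroup.of _
  rw [map_zpow, h, ← map_zpow, ← ofAdd_zsmul, smul_eq_mul, mul_one]
  rfl

end Action

section Expressions

variable {S : Type*} {M : CoxeterMatrix S}

theorem genT_commute {s t : S} (h : M s t = 2) : Commute (genT M s) (genT M t) := by
  have key := PresentedGroup.one_of_mem (rels := commRels M) ⟨s, t, h, rfl⟩
  rwa [map_mul, map_inv, mul_inv_eq_one, map_mul, map_mul] at key

theorem Expression.eval_cons (M : CoxeterMatrix S) (x : S × {p : ℤ // p ≠ 0}) (W : Expression S) :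
    Expression.eval M (x :: W) = genT M x.1 ^ (x.2 : ℤ) * Expression.eval M W := by
  simp only [Expression.eval, List.map_cons, List.prod_cons]

theorem Expression.eval_append (M : CoxeterMatrix S) (W W' : Expression S) :
    Expression.eval M (W ++ W') = Expression.eval M W * Expression.eval M W' := by
  simp only [Expression.eval, List.map_append, List.prod_append]

theorem ElemOp.cons (x : S × {p : ℤ // p ≠ 0}) {W W' : Expression S} (h : ElemOp M W W') :
    ElemOp M (x :: W) (x :: W') := by
  cases h with
  | merge U V s p q h => exact .merge (x :: U) V s p q h
  | cancel U V s p q h => exact .cancel (x :: U) V s p q h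
  | swap U V s t p q h => exact .swap (x :: U) V s t p q h

theorem ElemOp.eval_eq {W W' : Expression S} (h : ElemOp M W W') :
    Expression.eval M W = Expression.eval M W' := by
  cases h with
  | merge U V s p q h =>
    simp only [Expression.eval_append, Expression.eval_cons, zpow_add, mul_assoc]
  | cancel U V s p q h =>
    rw [Expression.eval_append, Expression.eval_append, Expression.eval_cons, Expression.eval_cons,
      ← mul_assoc (_ ^ _), ← zpow_add, h, zpow_zero, one_mul]
  | swap U V s t p q h =>
    rw [Expression.eval_append, Expression.eval_append, Expression.eval_cons, Expression.eval_cons,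
      Expression.eval_cons, Expression.eval_cons,
      ((genT_commute h).zpow_zpow p q).left_comm]

theorem Expression.eval_eq_of_reflTransGen {W W' : Expression S}
    (h : Relation.ReflTransGen (ElemOp M) W W') : Expression.eval M W' = Expression.eval M W := by
  induction h with
  | refl => rfl
  | tail _ hop ih => rw [← hop.eval_eq, ih]

theorem Expression.exists_isMReduced (M : CoxeterMatrix S) (W : Expression S) :
    ∃ W', Expression.IsMReduced M W' ∧ Expression.eval M W' = Expression.eval M W := by
  obtain ⟨W', hW', hmin⟩ := exists_minimalFor_of_wellFoundedLT
    (Relation.ReflTransGen (ElemOp M) W) List.length ⟨W, .refl⟩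
  exact ⟨W', fun V hV => (le_total _ _).elim id (hmin (hW'.trans hV)),
    Expression.eval_eq_of_reflTransGen hW'⟩

theorem Expression.eval_surjective (M : CoxeterMatrix S) :
    Function.Surjective (Expression.eval M) := by
  intro w
  obtain ⟨g, rfl⟩ := PresentedGroup.mk_surjective _ w
  induction g using FreeGroup.induction_on with
  | C1 => exact ⟨[], (map_one _).symm⟩
  | of s => exact ⟨[(s, ⟨1, one_ne_zero⟩)], by rw [eval_cons, zpow_one]; exact mul_one _⟩
  | inv_of s _ =>
    exact ⟨[(s, ⟨-1, neg_ne_zero.2 one_ne_zero⟩)], by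
      rw [eval_cons, zpow_neg_one, map_inv]; exact mul_one _⟩
  | mul g h hg hh =>
    obtain ⟨W, hW⟩ := hg
    obtain ⟨W', hW'⟩ := hh
    exact ⟨W ++ W', by rw [map_mul, ← hW, ← hW', eval_append]⟩

theorem reflTransGen_swap {x : S × {p : ℤ // p ≠ 0}} {A : Expression S}
    (hA : ∀ a ∈ A, M x.1 a.1 = 2) (V : Expression S) :
    Relation.ReflTransGen (ElemOp M) (x :: (A ++ V)) (A ++ x :: V) := by
  induction A with
  | nil => exact .refl
  | cons a A ih =>
    exact .head (.swap [] (A ++ V) x.1 a.1 x.2 a.2 (hA a List.mem_cons_self))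
      ((ih fun b hb => hA b (List.mem_cons_of_mem a hb)).lift (a :: ·) fun _ _ => ElemOp.cons a)

namespace Expression.IsMReduced

theorem of_cons {x : S × {p : ℤ // p ≠ 0}} {W : Expression S}
    (h : Expression.IsMReduced M (x :: W)) : Expression.IsMReduced M W := fun W' hW =>
  Nat.succ_le_succ_iff.1 (h (x :: W') (hW.lift (x :: ·) fun _ _ => ElemOp.cons x))

theorem of_append {A B : Expression S} (h : Expression.IsMReduced M (A ++ B)) :
    Expression.IsMReduced M B := by
  induction A with
  | nil => exact h
  | cons a A ih => exact ih h.of_cons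

theorem ne_of_commute {x z : S × {p : ℤ // p ≠ 0}} {A B : Expression S}
    (h : Expression.IsMReduced M (x :: (A ++ z :: B))) (hA : ∀ a ∈ A, M x.1 a.1 = 2) :
    z.1 ≠ x.1 := by
  obtain ⟨s, p⟩ := x
  obtain ⟨t, q⟩ := z
  rintro rfl
  have hswap := reflTransGen_swap hA ((t, q) :: B)
  by_cases hpq : (p : ℤ) + q = 0
  · have := h _ (hswap.tail (.cancel A B t p q hpq))
    simp at this
  · have := h _ (hswap.tail (.merge A B t p q hpq))
    simp at this

theorem commute_or_exists {x : S × {p : ℤ // p ≠ 0}} {W : Expression S}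
    (h : Expression.IsMReduced M (x :: W)) :
    (∀ a ∈ W, M x.1 a.1 = 2) ∨ ∃ A z B, W = A ++ z :: B ∧ (∀ a ∈ A, M x.1 a.1 = 2) ∧
      z.1 ≠ x.1 ∧ M x.1 z.1 ≠ 2 := by
  by_cases hW : ∃ z ∈ W, M x.1 z.1 ≠ 2
  · obtain ⟨A, z, B, rfl, hz, hA⟩ := exists_eq_append_cons_of_exists_mem hW
    simp only [not_not] at hA
    exact .inr ⟨A, z, B, rfl, hA, h.ne_of_commute hA, hz⟩
  · push Not at hW
    exact .inl hW

end Expression.IsMReduced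

end Expressions

section Injectivity

variable {S : Type*}

/-- The arc of the auxiliary circle of `r` through its crossing with the circle of `r`. -/
def testArc (r : S) : FreeGroup (Letter S) :=
  of (Sum.inr r, r, false) * of (Sum.inr r, r, true)

variable [LinearOrder S] {M : CoxeterMatrix S}

theorem toWord_testArc (r : S) :
    (testArc r).toWord = [((Sum.inr r, r, false), true), ((Sum.inr r, r, true), true)] := by
  simpa [testArc] using
    toWord_prod_map_of [((Sum.inr r, r, false) : Letter S), (Sum.inr r, r, true)]

theorem passes_testArc (r : S) :
    Passes (Sum.inr r, r, false) (Sum.inr r, r, true) (testArc r) :=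
  .inl (by rw [toWord_testArc])

theorem not_passes_testArc (r s u : S) :
    ¬ Passes (Sum.inl s, u, false) (Sum.inl s, u, true) (testArc r) := by
  rintro (h | h) <;>
  · have := h.subset List.mem_cons_self
    simp [toWord_inv, toWord_testArc, invRev] at this

theorem twist_testArc (o : CyclicListing S) {s r : S} (k : ℤ) (h : r ≠ s) :
    twist M o s k (testArc r) = testArc r := by
  rw [testArc, map_mul, twist_of_eq_self fun hr => absurd hr h,
    twist_of_eq_self fun hr => absurd hr h]

/-- The action of `H(Γ)` through `f`. -/
noncomputable def powAction (hM : IsSmallType M) (o : CyclicListing S) (m : S → ℕ) :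
    HGroup M →* Monoid.End (FreeGroup (Letter S)) :=
  (Units.coeHom _).comp ((artinAction hM o).comp (powHom M m))

variable {hM : IsSmallType M} {o : CyclicListing S} {m : S → ℕ}

theorem powAction_eval_cons (x : S × {p : ℤ // p ≠ 0}) (W : Expression S)
    (g : FreeGroup (Letter S)) :
    powAction hM o m (Expression.eval M (x :: W)) g =
      twist M o x.1 (m x.1 * x.2) (powAction hM o m (Expression.eval M W) g) := by
  have hx : powAction hM o m (genT M x.1 ^ (x.2 : ℤ)) = twist M o x.1 (m x.1 * x.2) := by
    change Units.val (artinAction hM o (powHom M m (genT M x.1 ^ (x.2 : ℤ)))) = _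
    rw [map_zpow, powHom_genT, ← zpow_natCast, ← zpow_mul, coe_artinAction_sigma_zpow]
  rw [Expression.eval_cons, map_mul, hx]
  rfl

theorem powAction_eval_testArc {W : Expression S} {r : S} (h : ∀ a ∈ W, r ≠ a.1) :
    powAction hM o m (Expression.eval M W) (testArc r) = testArc r := by
  induction W with
  | nil => exact congrArg (· (testArc r)) (map_one (powAction hM o m))
  | cons a W ih =>
    rw [powAction_eval_cons, ih fun b hb => h b (List.mem_cons_of_mem a hb),
      twist_testArc o _ (h a List.mem_cons_self)]

theorem passes_powAction_eval_append {A : Expression S} (B : Expression S) {t u : S}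
    {g : FreeGroup (Letter S)} (hA : ∀ a ∈ A, t ≠ a.1 ∧ u ≠ a.1)
    (h : Passes (Sum.inl t, u, false) (Sum.inl t, u, true)
      (powAction hM o m (Expression.eval M B) g)) :
    Passes (Sum.inl t, u, false) (Sum.inl t, u, true)
      (powAction hM o m (Expression.eval M (A ++ B)) g) := by
  induction A with
  | nil => exact h
  | cons a A ih =>
    obtain ⟨ht, hu⟩ := hA a List.mem_cons_self
    rw [List.cons_append, powAction_eval_cons]
    exact passes_twist _ (fun e => ht (Sum.inl_injective e)) hu
      (ih fun b hb => hA b (List.mem_cons_of_mem a hb))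

theorem exists_passes_powAction_eval_cons (hM : IsSmallType M) (o : CyclicListing S)
    (hm : ∀ s, 2 ≤ m s) {x : S × {p : ℤ // p ≠ 0}} {W : Expression S}
    (hW : Expression.IsMReduced M (x :: W)) (u : S) :
    ∃ r, Passes (Sum.inl x.1, u, false) (Sum.inl x.1, u, true)
      (powAction hM o m (Expression.eval M (x :: W)) (testArc r)) := by
  induction hn : W.length using Nat.strong_induction_on generalizing x W u with
  | _ n ih =>
  have hk : 2 ≤ ((m x.1 : ℤ) * x.2).natAbs := by
    rw [Int.natAbs_mul, Int.natAbs_natCast]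
    exact (hm x.1).trans (Nat.le_mul_of_pos_right _ (Int.natAbs_pos.2 x.2.2))
  have hne : ∀ {s t}, M s t = 2 → s ≠ t := by
    rintro s _ h rfl
    simp at h
  simp only [powAction_eval_cons x W]
  rcases hW.commute_or_exists with hcomm | ⟨A, z, B, rfl, hA, hzx, hz⟩
  · refine ⟨x.1, passes_twist_of_crosses (v := Sum.inr x.1) rfl u hk ?_⟩
    rw [powAction_eval_testArc fun a ha => hne (hcomm a ha)]
    exact passes_testArc x.1
  · obtain ⟨r, hr⟩ := ih B.length (by simp [← hn]; omega) hW.of_cons.of_append x.1 rfl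
    have hzx3 : M z.1 x.1 = 3 := M.symmetric x.1 z.1 ▸ (hM _ _ hzx.symm).resolve_left hz
    refine ⟨r, passes_twist_of_crosses (v := Sum.inl z.1) hzx3 u hk ?_⟩
    refine passes_powAction_eval_append (z :: B) (fun a ha => ⟨fun hza => ?_, hne (hA a ha)⟩) hr
    exact hz (hza ▸ hA a ha)

end Injectivity

variable {S : Type*} [Finite S] {M : CoxeterMatrix S} {m : S → ℕ}

theorem powHom_eval_ne_one (hM : IsSmallType M) (hm : ∀ s, 2 ≤ m s) {W : Expression S}
    (hne : W ≠ []) (hW : Expression.IsMReduced M W) : powHom M m (Expression.eval M W) ≠ 1 := by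
  classical
  have := linearOrderOfSTO (WellOrderingRel (α := S))
  obtain ⟨o⟩ := CyclicListing.nonempty S
  obtain ⟨x, W, rfl⟩ := List.exists_cons_of_ne_nil hne
  obtain ⟨r, hr⟩ := exists_passes_powAction_eval_cons hM o hm hW x.1
  intro h
  have hact : powAction hM o m (Expression.eval M (x :: W)) = 1 := by
    simp only [powAction, MonoidHom.comp_apply, h, map_one]
  rw [hact] at hr
  exact not_passes_testArc r x.1 x.1 hr

theorem powHom_injective (hM : IsSmallType M) (hm : ∀ s, 2 ≤ m s) :
    Function.Injective (powHom M m) := by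
  refine (injective_iff_map_eq_one _).2 fun w hw => ?_
  obtain ⟨W, rfl⟩ := Expression.eval_surjective M w
  obtain ⟨W', hred, heval⟩ := Expression.exists_isMReduced M W
  rw [← heval] at hw ⊢
  have hnil : W' = [] := by
    by_contra hne
    exact powHom_eval_ne_one hM hm hne hred hw
  rw [hnil]
  rfl

theorem range_powHom {S : Type*} (M : CoxeterMatrix S) (m : S → ℕ) :
    (powHom M m).range = Subgroup.closure (Set.range fun s : S => sigma M s ^ m s) := by
  rw [MonoidHom.range_eq_map, ← PresentedGroup.closure_range_of, MonoidHom.map_closure,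
    ← Set.range_comp]
  exact congrArg (Subgroup.closure ∘ Set.range) (funext (powHom_genT M m))

theorem exists_mulEquiv_closure (hM : IsSmallType M) (hm : ∀ s, 2 ≤ m s) :
    ∃ e : HGroup M ≃* Subgroup.closure (Set.range fun s : S => sigma M s ^ m s),
      ∀ s : S, (e (genT M s) : ArtinGroup M) = sigma M s ^ m s :=
  ⟨(MonoidHom.ofInjective (powHom_injective hM hm)).trans
    (MulEquiv.subgroupCongr (range_powHom M m)), powHom_genT M m⟩

end ArtinTits

theorem proposition7_general {S : Type*} [Finite S] (M : CoxeterMatrix S)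
    (hsmall : ArtinTits.IsSmallType M) :
    (∀ m : S → ℕ, (∀ s, 2 ≤ m s) →
      (∀ w : ArtinTits.HGroup M,
        (∃ W : ArtinTits.Expression S,
          W ≠ [] ∧ ArtinTits.Expression.IsMReduced M W ∧ ArtinTits.Expression.eval M W = w) →
        ArtinTits.powHom M m w ≠ 1) ∧
      Function.Injective (ArtinTits.powHom M m) ∧
      ∃ e : ArtinTits.HGroup M ≃*
          Subgroup.closure (Set.range fun s : S => ArtinTits.sigma M s ^ m s),
        ∀ s : S, (e (ArtinTits.genT M s) : ArtinTits.ArtinGroup M) = ArtinTits.sigma M s ^ m s) ∧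
    ∃ e : ArtinTits.HGroup M ≃*
        Subgroup.closure (Set.range fun s : S => ArtinTits.sigma M s ^ 2),
      ∀ s : S, (e (ArtinTits.genT M s) : ArtinTits.ArtinGroup M) = ArtinTits.sigma M s ^ 2 := by
  refine ⟨fun m hm => ⟨?_, ArtinTits.powHom_injective hsmall hm,
    ArtinTits.exists_mulEquiv_closure hsmall hm⟩,
    ArtinTits.exists_mulEquiv_closure hsmall fun _ => le_rfl⟩
  rintro _ ⟨W, hne, hW, rfl⟩
  exact ArtinTits.powHom_eval_ne_one hsmall hm hne hW

theorem proposition7 {S : Type*} [Finite S] (M : CoxeterMatrix S)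
    (hsmall : ArtinTits.IsSmallType M) (hconn : (ArtinTits.coxeterGraph M).Connected) :
    (∀ m : S → ℕ, (∀ s, 2 ≤ m s) →
      (∀ w : ArtinTits.HGroup M,
        (∃ W : ArtinTits.Expression S,
          W ≠ [] ∧ ArtinTits.Expression.IsMReduced M W ∧ ArtinTits.Expression.eval M W = w) →
        ArtinTits.powHom M m w ≠ 1) ∧
      Function.Injective (ArtinTits.powHom M m) ∧
      ∃ e : ArtinTits.HGroup M ≃*
          Subgroup.closure (Set.range fun s : S => ArtinTits.sigma M s ^ m s),
        ∀ s : S, (e (ArtinTits.genT M s) : ArtinTits.ArtinGroup M) = ArtinTits.sigma M s ^ m s) ∧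
    ∃ e : ArtinTits.HGroup M ≃*
        Subgroup.closure (Set.range fun s : S => ArtinTits.sigma M s ^ 2),
      ∀ s : S, (e (ArtinTits.genT M s) : ArtinTits.ArtinGroup M) = ArtinTits.sigma M s ^ 2 :=
  proposition7_general M hsmall
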